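/- All locally convex spaces are over $\mathbb{C}$. For a locally convex space $X$, let $X^\star$ denote the space of all continuous linear functionals $f:X\to\mathbb{C}$ with the topology of uniform convergence on totally bounded subsets of $X$; $X$ is called \emph{stereotype} if the natural map $X\to X^{\star\star}$, $x\mapsto(f\mapsto f(x))$, is an isomorphism of locally convex spaces (a linear homeomorphism). A locally convex space $Y$ is called \emph{co-complete} if every linear functional $f:Y\to\mathbb{C}$ whose restriction to each totally bounded set $K\subseteq Y$ is continuous is continuous on the whole of $Y$. A continuous linear map $\varphi:X\to Y$ of locally convex spaces is called \emph{closed} if for each totally bounded set $T\subseteq\overline{\varphi(X)}\subseteq Y$ there is a totally bounded set $S\subseteq X$ such that $\varphi(S)\supseteq T$. \textbf{Theorem.} Let $X$ and $Y$ be stereotype spaces, and let $\varphi:X\to Y$ be a closed bijective continuous linear map. If $Y$ is co-complete, then $\varphi$ is an isomorphism of stereotype spaces, i.e. a linear homeomorphism of $X$ onto $Y$. -/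

import Mathlib

/-- The stereotype dual `X⋆` of a locally convex space `X` over `ℂ`: the space of continuous linear
functionals on `X` with the topology of uniform convergence on totally bounded subsets of `X`. -/
abbrev StereotypeDual (X : Type*) [AddCommGroup X] [Module ℂ X] [UniformSpace X] : Type _ :=
  UniformConvergenceCLM (RingHom.id ℂ) ℂ {K : Set X | TotallyBounded K}

/-- Evaluation at a point is continuous on the stereotype dual. -/
theorem StereotypeDual.continuous_eval {X : Type*} [AddCommGroup X] [Module ℂ X] [UniformSpace X]
    (x : X) : Continuous fun f : StereotypeDual X => f x := by
  have : ContinuousEvalConst (StereotypeDual X) X ℂ :=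
    UniformConvergenceCLM.continuousEvalConst (RingHom.id ℂ) ℂ {K : Set X | TotallyBounded K}
      (Set.sUnion_eq_univ_iff.2 fun y => ⟨{y}, totallyBounded_singleton y, rfl⟩)
  exact continuous_eval_const x

/-- Evaluation at `x`, as an element of the second stereotype dual `X⋆⋆`. -/
noncomputable def StereotypeDual.evalAt {X : Type*} [AddCommGroup X] [Module ℂ X] [UniformSpace X] (x : X) :
    StereotypeDual (StereotypeDual X) :=
  show StereotypeDual X →L[ℂ] ℂ from
    { toFun := fun f => f x
      map_add' := fun _ _ => rfl
      map_smul' := fun _ _ => rfl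
      cont := StereotypeDual.continuous_eval x }

/-- The natural map `X → X⋆⋆`, sending `x` to `f ↦ f x`. -/
noncomputable def stereotypeEval (X : Type*) [AddCommGroup X] [Module ℂ X] [UniformSpace X] :
    X →ₗ[ℂ] StereotypeDual (StereotypeDual X) where
  toFun := StereotypeDual.evalAt
  map_add' x y := by
    ext f
    exact map_add f x y
  map_smul' c x := by
    ext f
    exact map_smul f c x

/-- A locally convex space `X` over `ℂ` is stereotype if the natural linear map `X → X⋆⋆` is an
isomorphism of locally convex spaces, i.e. a linear homeomorphism. -/
def IsStereotype (X : Type*) [AddCommGroup X] [Module ℂ X] [UniformSpace X] [IsUniformAddGroup X]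
    [ContinuousSMul ℂ X] [LocallyConvexSpace ℝ X] : Prop :=
  IsHomeomorph (stereotypeEval X)

/-- A locally convex space `X` over `ℂ` is co-complete if every linear functional on `X` that is
continuous on each totally bounded subset is continuous on the whole of `X`. -/
def IsCoComplete (X : Type*) [AddCommGroup X] [Module ℂ X] [UniformSpace X] [IsUniformAddGroup X]
    [ContinuousSMul ℂ X] [LocallyConvexSpace ℝ X] : Prop :=
  ∀ f : X →ₗ[ℂ] ℂ, (∀ K : Set X, TotallyBounded K → ContinuousOn f K) → Continuous f

/-- A continuous linear map of locally convex spaces is closed (in the sense of the theory of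
stereotype spaces) if every totally bounded subset of the closure of its range is contained in the
image of a totally bounded set. -/
def IsClosedMorphism {X Y : Type*}
    [AddCommGroup X] [Module ℂ X] [UniformSpace X] [IsUniformAddGroup X] [ContinuousSMul ℂ X]
    [LocallyConvexSpace ℝ X]
    [AddCommGroup Y] [Module ℂ Y] [UniformSpace Y] [IsUniformAddGroup Y] [ContinuousSMul ℂ Y]
    [LocallyConvexSpace ℝ Y] (φ : X →L[ℂ] Y) : Prop :=
  ∀ T : Set Y, TotallyBounded T → T ⊆ closure (Set.range φ) →
    ∃ S : Set X, TotallyBounded S ∧ T ⊆ φ '' S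

/-!
The content of the theorem is that the inverse `ψ` of `φ` is continuous. Closedness of `φ` says
exactly that `ψ` carries totally bounded sets to totally bounded sets. Two facts then suffice.

* `f ∘ ψ` is continuous for each `f ∈ X⋆`. By co-completeness of `Y` it is enough to check this on a
  totally bounded `T ⊆ Y`. As `X → X⋆⋆` is onto, totally bounded subsets of `X` are relatively weakly
  compact (`IsStereotype.exists_weak_limit`, a form of the Banach-Alaoglu theorem), and a weakly
  continuous injection is a weak homeomorphism on a weakly compact set; so `ψ` is weakly continuous
  on `T` (`continuousOn_comp_of_leftInverse`).
* A linear map `ψ` between stereotype spaces is continuous once it preserves total boundedness and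
  pulls continuous functionals back to continuous functionals (`continuous_of_dual`): the transpose
  `X⋆ → Y⋆` is then continuous, hence so is the second transpose `Y⋆⋆ → X⋆⋆`, which is `ψ` under the
  identification of a stereotype space with its second dual.
-/

open Filter Topology

section

variable {X Y : Type*}
  [AddCommGroup X] [Module ℂ X] [UniformSpace X] [IsUniformAddGroup X] [ContinuousSMul ℂ X]
  [LocallyConvexSpace ℝ X]
  [AddCommGroup Y] [Module ℂ Y] [UniformSpace Y] [IsUniformAddGroup Y] [ContinuousSMul ℂ Y]
  [LocallyConvexSpace ℝ Y]

omit [ContinuousSMul ℂ X] [LocallyConvexSpace ℝ X] in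
theorem exists_tendsto_of_totallyBounded_mem {S : Set X} (hS : TotallyBounded S)
    (h : Ultrafilter X) (hSh : S ∈ h) (u : X →L[ℂ] ℂ) : ∃ z : ℂ, Tendsto u h (𝓝 z) := by
  have hK : IsCompact (closure (u '' S)) :=
    (hS.image u.uniformContinuous).closure.isCompact_of_isClosed isClosed_closure
  obtain ⟨z, -, hz⟩ := hK.ultrafilter_le_nhds (h.map u) <|
    le_principal_iff.2 <| mem_of_superset (image_mem_map hSh) subset_closure
  exact ⟨z, hz⟩

/-- Totally bounded subsets of a stereotype space are relatively weakly compact. The pointwise limit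
on `X⋆` along the ultrafilter is at most `ε` on the neighbourhood `{u | ∀ s ∈ S, ‖u s‖ ≤ ε}` of `0`,
so it lies in `X⋆⋆`, that is, it is the evaluation at a point. -/
theorem IsStereotype.exists_weak_limit (hX : IsStereotype X) {S : Set X} (hS : TotallyBounded S)
    (h : Ultrafilter X) (hSh : S ∈ h) :
    ∃ x : X, ∀ u : StereotypeDual X, Tendsto u h (𝓝 (u x)) := by
  choose L hL using fun u : StereotypeDual X => exists_tendsto_of_totallyBounded_mem hS h hSh u
  let Λ : StereotypeDual X →ₗ[ℂ] ℂ :=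
    { toFun := L
      map_add' := fun u v => tendsto_nhds_unique (hL (u + v)) ((hL u).add (hL v))
      map_smul' := fun c u => tendsto_nhds_unique (hL (c • u)) ((hL u).const_smul c) }
  have hΛ : Continuous Λ := by
    refine continuous_of_tendsto_nhds_zero Λ ?_
    rw [Metric.nhds_basis_closedBall.tendsto_right_iff]
    intro ε hε
    filter_upwards [UniformConvergenceCLM.eventually_nhds_zero_mapsTo (RingHom.id ℂ)
      (𝔖 := {K : Set X | TotallyBounded K}) hS (Metric.closedBall_mem_nhds (0 : ℂ) hε)] with u hu
    exact Metric.isClosed_closedBall.mem_of_tendsto (hL u) (mem_of_superset hSh hu)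
  obtain ⟨x, hx⟩ := hX.surjective (show StereotypeDual X →L[ℂ] ℂ from ⟨Λ, hΛ⟩)
  refine ⟨x, fun u => ?_⟩
  have : u x = L u := congrArg (fun F : StereotypeDual (StereotypeDual X) => F u) hx
  rw [this]
  exact hL u

theorem IsStereotype.eq_of_forall_dual_eq (hX : IsStereotype X) {x y : X}
    (h : ∀ u : StereotypeDual X, u x = u y) : x = y :=
  hX.injective (ContinuousLinearMap.ext h)

/-- On a set with totally bounded image, the inverse of a continuous bijection of stereotype spaces
is continuous into the weak topology. -/
theorem continuousOn_comp_of_leftInverse (hX : IsStereotype X) (hY : IsStereotype Y)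
    (φ : X →L[ℂ] Y) (ψ : Y →ₗ[ℂ] X) (hψφ : Function.LeftInverse ψ φ)
    (hφψ : Function.RightInverse ψ φ) {T : Set Y} (hT : TotallyBounded (ψ '' T))
    (f : StereotypeDual X) : ContinuousOn (fun y => f (ψ y)) T := by
  intro t _
  rw [ContinuousWithinAt, tendsto_iff_ultrafilter]
  intro g hg
  obtain ⟨x, hx⟩ := hX.exists_weak_limit hT (g.map ψ)
    (image_mem_map (le_principal_iff.1 (hg.trans inf_le_right)))
  -- Along `g`, the functional `v ∘ φ ∘ ψ = v` tends both to `v (φ x)` and to `v t`.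
  have hxt : φ x = t := hY.eq_of_forall_dual_eq fun v => by
    have h₁ : Tendsto v g (𝓝 (v (φ x))) :=
      (tendsto_map'_iff.1 (hx (show X →L[ℂ] ℂ from ContinuousLinearMap.comp v φ))).congr
        fun y => congrArg v (hφψ y)
    have h₂ : Tendsto v g (𝓝 (v t)) :=
      (ContinuousLinearMap.continuous (v : Y →L[ℂ] ℂ)).continuousAt.mono_left
        (hg.trans inf_le_left)
    exact tendsto_nhds_unique h₁ h₂
  rw [← hxt, hψφ x]
  exact tendsto_map'_iff.1 (hx f)

theorem continuous_of_dual (hX : IsStereotype X) (hY : IsStereotype Y) (ψ : Y →ₗ[ℂ] X)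
    (hψ : ∀ T : Set Y, TotallyBounded T → TotallyBounded (ψ '' T))
    (hdual : ∀ f : StereotypeDual X, Continuous fun y => f (ψ y)) : Continuous ψ := by
  let A : StereotypeDual X →ₗ[ℂ] StereotypeDual Y :=
    { toFun := fun f => show Y →L[ℂ] ℂ from ⟨(f : X →L[ℂ] ℂ).toLinearMap ∘ₗ ψ, hdual f⟩
      map_add' := fun _ _ => rfl
      map_smul' := fun _ _ => rfl }
  have hA : Continuous A := by
    refine continuous_of_tendsto_nhds_zero A ?_
    rw [UniformConvergenceCLM.nhds_zero_eq (RingHom.id ℂ) ℂ {K : Set Y | TotallyBounded K}]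
    simp only [tendsto_iInf, tendsto_principal]
    intro T hT U hU
    filter_upwards [UniformConvergenceCLM.eventually_nhds_zero_mapsTo (RingHom.id ℂ)
      (𝔖 := {K : Set X | TotallyBounded K}) (hψ T hT) hU] with f hf y hy
    exact hf (Set.mem_image_of_mem ψ hy)
  let B : StereotypeDual X →L[ℂ] StereotypeDual Y := ⟨A, hA⟩
  let C : StereotypeDual (StereotypeDual Y) →L[ℂ] StereotypeDual (StereotypeDual X) :=
    ContinuousLinearMap.precompUniformConvergenceCLM ℂ _ _ B
      fun K hK => TotallyBounded.image hK B.uniformContinuous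
  rw [hX.isInducing.continuous_iff]
  -- The evaluation at `ψ y` is the second transpose of `ψ` applied to the evaluation at `y`.
  have hC : stereotypeEval X ∘ ψ = C ∘ stereotypeEval Y := rfl
  rw [hC]
  exact C.continuous.comp hY.continuous

end

theorem mainTheorem9 {X Y : Type*}
    [AddCommGroup X] [Module ℂ X] [UniformSpace X] [IsUniformAddGroup X] [ContinuousSMul ℂ X]
    [LocallyConvexSpace ℝ X]
    [AddCommGroup Y] [Module ℂ Y] [UniformSpace Y] [IsUniformAddGroup Y] [ContinuousSMul ℂ Y]
    [LocallyConvexSpace ℝ Y]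
    (hX : IsStereotype X) (hY : IsStereotype Y) (hYco : IsCoComplete Y)
    (φ : X →L[ℂ] Y) (hbij : Function.Bijective φ) (hclosed : IsClosedMorphism φ) :
    ∃ e : X ≃L[ℂ] Y, (e : X →L[ℂ] Y) = φ := by
  let e : X ≃ₗ[ℂ] Y := LinearEquiv.ofBijective φ.toLinearMap hbij
  have hψφ : Function.LeftInverse e.symm φ := e.symm_apply_apply
  have hφψ : Function.RightInverse e.symm φ := e.apply_symm_apply
  have htb : ∀ T : Set Y, TotallyBounded T → TotallyBounded (e.symm '' T) := by
    intro T hT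
    obtain ⟨S, hS, hTS⟩ := hclosed T hT (by simp [hbij.surjective.range_eq])
    refine hS.subset (Set.image_subset_iff.2 fun y hy => ?_)
    obtain ⟨x, hx, rfl⟩ := hTS hy
    simpa [hψφ x] using hx
  have hdual (f : StereotypeDual X) : Continuous fun y => f (e.symm y) :=
    hYco ((f : X →L[ℂ] ℂ).toLinearMap ∘ₗ e.symm.toLinearMap) fun T hT =>
      continuousOn_comp_of_leftInverse hX hY φ e.symm.toLinearMap hψφ hφψ (htb T hT) f
  exact ⟨⟨e, φ.continuous, continuous_of_dual hX hY e.symm.toLinearMap htb hdual⟩, rfl⟩
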